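/- For a nonzero $2$-adic number $z$ (in particular, for a nonzero integer, rational number, or $2$-adic integer) let $\nu(z)$ denote the exponent of $2$ in $z$, and let $\nu(0)=\infty$. For a positive integer $n$ and any integer $x$ let $$P_n(x)=\frac1{n!}\sum_{j\text{ odd}}\binom nj j^x\in\mathbb Q ,$$ the sum being over the odd integers $j$ with $1\le j\le n$. **Theorem 2.1.** Let $e$, $\Delta$, $p$ be integers with $e\ge2$, $1\le\Delta\le4$ and $0\le p<2^{e-1}$. Then there exists a $2$-adic integer $x_{e,\Delta,p}\in\mathbb Z_2$ such that, for all integers $x$, $$\nu\bigl(P_{2^e+\Delta}(2^{e-1}x+p)\bigr)=\nu(x-x_{e,\Delta,p})+c ,$$ where $$c=\begin{cases}2&\text{if } e=2 \text{ and either } \Delta=3,\ p \text{ is even, or } \Delta=4,\ p\text{ is odd},\\ 1&\text{if } e>2 \text{ and either } \Delta=3,\ p\text{ is even, or } \Delta=4,\ p\text{ is odd},\\ 0&\text{otherwise.}\end{cases}$$ -/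

import Mathlib

/-- The partial Stirling function
`P_n(x) = (1 / n!) * ∑_{j odd} (n choose j) * j ^ x`, a rational number, for every integer `x`
(negative exponents included; every `j` in the sum is odd, hence nonzero). -/
def partialStirling (n : ℕ) (x : ℤ) : ℚ :=
  (1 / (n.factorial : ℚ)) *
    ∑ j ∈ (Finset.range (n + 1)).filter Odd, (n.choose j : ℚ) * (j : ℚ) ^ x

/-- The exponent of `2` in a 2-adic number, with values in `ℤ ∪ {∞}`; it is `⊤` exactly at `0`.
On integers, rational numbers and 2-adic integers (viewed in `ℚ_[2]`) it is the usual exponent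
of `2`. -/
noncomputable def nu (z : ℚ_[2]) : WithTop ℤ :=
  Padic.addValuation z

open Finset Filter Topology

/-! Put n = 2^e + Δ, k = 2^(e-1) and f(x) = P_n(kx + p). The theorem says that f multiplies 2-adic
distances by 2^(-c) and has a zero in ℤ_2. It is enough that ‖f(x + 2^m) - f(x)‖ = 2^(-(m+c)) for
all x and m, and that ‖f(0)‖ ≤ 2^(-c): as the residue field is F_2, a zero can then be found one
binary digit at a time (`exists_padicInt_zero`).

For the increments, expand y^(2^(e-1+m)) = (1 + (y^2 - 1))^(2^(e-2+m)). The binomial coefficient of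
index 2^(e-2) has valuation exactly m, and all other terms of positive index contribute valuation
greater than m (`norm_choose_mul_oddSum_le`). So the increment at exponent x has valuation m once
the functional is odd at X^x (X^2 - 1)^(2^(e-2)). Modulo 2 this polynomial is X^x (X - 1)(X - 3)⋯(X
- (2k - 1)), which leaves at most the two nodes 2k+1 and 2k+3. Its moments, computed by recurrence,
are odd for Δ = 1, 2, for Δ = 3 with x odd, and for Δ = 4 with x even and positive.

For Δ = 4 and x odd, the reflection j ↦ n - j gives 2 P_n(x) = n G(x), whence c = ν(n) - 1. The
leading term of G(x) is x P_n(x - 1), whose exponent is even, so the previous argument applies to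
it. The case Δ = 3, x even, follows from Δ = 4 by the recurrence. Negative exponents are reached by
2-adic continuity. -/

/-! ### The functional, its recurrence in n, and integrality on integer polynomials -/

/-- The functional `g ↦ (1 / n!) * ∑_{j odd} (n choose j) * g j`. -/
noncomputable def oddSum (n : ℕ) (g : ℕ → ℚ_[2]) : ℚ_[2] :=
  (n.factorial : ℚ_[2])⁻¹ * ∑ j ∈ (range (n + 1)).filter Odd, (n.choose j : ℚ_[2]) * g j

theorem partialStirling_eq_oddSum (n : ℕ) (x : ℤ) :
    ((partialStirling n x : ℚ) : ℚ_[2]) = oddSum n (fun j => (j : ℚ_[2]) ^ x) := by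
  simp [partialStirling, oddSum]

theorem oddSum_congr {n : ℕ} {g h : ℕ → ℚ_[2]} (H : ∀ j, Odd j → j ≤ n → g j = h j) :
    oddSum n g = oddSum n h := by
  unfold oddSum
  congr 1
  refine sum_congr rfl fun j hj => ?_
  rw [mem_filter, mem_range] at hj
  rw [H j hj.2 (by omega)]

theorem oddSum_sub (n : ℕ) (g h : ℕ → ℚ_[2]) :
    oddSum n (fun j => g j - h j) = oddSum n g - oddSum n h := by
  simp [oddSum, mul_sub, sum_sub_distrib]

theorem oddSum_const_mul (n : ℕ) (c : ℚ_[2]) (g : ℕ → ℚ_[2]) :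
    oddSum n (fun j => c * g j) = c * oddSum n g := by
  simp only [oddSum, mul_sum]
  refine sum_congr rfl fun j _ => by ring

theorem oddSum_sum {ι : Type*} (n : ℕ) (s : Finset ι) (g : ι → ℕ → ℚ_[2]) :
    oddSum n (fun j => ∑ i ∈ s, g i j) = ∑ i ∈ s, oddSum n (g i) := by
  simp only [oddSum, mul_sum]
  exact sum_comm

theorem oddSum_zero (g : ℕ → ℚ_[2]) : oddSum 0 g = 0 := by
  simp [oddSum, filter_singleton]

/-- This is the identity (n + 1 - j) C(n+1, j) = (n + 1) C(n, j). It drives the later inductions on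
the exponent. -/
theorem oddSum_succ_mul (n : ℕ) (g : ℕ → ℚ_[2]) :
    oddSum (n + 1) (fun j => (j : ℚ_[2]) * g j) =
      ((n : ℚ_[2]) + 1) * oddSum (n + 1) g - oddSum n g := by
  have h1 : oddSum n g = (n.factorial : ℚ_[2])⁻¹ *
      ∑ j ∈ (range (n + 1 + 1)).filter Odd, (n.choose j : ℚ_[2]) * g j := by
    unfold oddSum
    congr 1
    refine sum_subset (filter_subset_filter _ (range_mono (by omega))) fun j hj hj' => ?_
    simp only [mem_filter, mem_range, not_and] at hj hj'
    have : ¬ j < n + 1 := fun h => hj' h hj.2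
    rw [Nat.choose_eq_zero_of_lt (by omega)]
    simp
  have hn : ((n : ℚ_[2]) + 1) ≠ 0 := by exact_mod_cast n.succ_ne_zero
  rw [h1, eq_sub_iff_add_eq]
  simp only [oddSum, Nat.factorial_succ, mul_sum, ← sum_add_distrib]
  refine sum_congr rfl fun j hj => ?_
  simp only [mem_filter, mem_range] at hj
  have h2 := Nat.choose_mul_succ_eq n j
  have h3 : (n.choose j : ℚ_[2]) * (n + 1) = (n + 1).choose j * (n + 1 - j) := by
    have : ((n + 1 - j : ℕ) : ℚ_[2]) = n + 1 - j := by
      rw [Nat.cast_sub (by omega)]; push_cast; ring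
    rw [← this]
    exact_mod_cast h2
  have hf : (n.factorial : ℚ_[2]) ≠ 0 := by exact_mod_cast n.factorial_ne_zero
  have h4 : (n.choose j : ℚ_[2]) = (n + 1).choose j * (n + 1 - j) / (n + 1) := by
    rw [← h3]; field_simp
  rw [h4]
  push_cast
  field_simp
  ring

theorem norm_natCast_le_one (n : ℕ) : ‖(n : ℚ_[2])‖ ≤ 1 := by
  exact_mod_cast Padic.norm_int_le_one (p := 2) (n : ℤ)

theorem padic_norm_add_le {a b : ℚ_[2]} {r : ℝ} (ha : ‖a‖ ≤ r) (hb : ‖b‖ ≤ r) : ‖a + b‖ ≤ r :=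
  (Padic.nonarchimedean a b).trans (max_le ha hb)

theorem padic_norm_sub_le {a b : ℚ_[2]} {r : ℝ} (ha : ‖a‖ ≤ r) (hb : ‖b‖ ≤ r) : ‖a - b‖ ≤ r := by
  rw [sub_eq_add_neg]
  exact padic_norm_add_le ha (by rwa [norm_neg])

theorem padic_norm_sum_le {ι : Type*} {s : Finset ι} {g : ι → ℚ_[2]} {r : ℝ} (hr : 0 ≤ r)
    (h : ∀ i ∈ s, ‖g i‖ ≤ r) : ‖∑ i ∈ s, g i‖ ≤ r :=
  IsUltrametricDist.norm_sum_le_of_forall_le_of_nonneg hr h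

theorem oddSum_one (n : ℕ) :
    oddSum (n + 1) (fun _ => 1) = 2 ^ n / ((n + 1).factorial : ℚ_[2]) := by
  have h1 : ∑ j ∈ range (n + 1 + 1), ((n + 1).choose j : ℚ_[2]) = 2 ^ (n + 1) := by
    exact_mod_cast Nat.sum_range_choose (n + 1)
  have h2 : ∑ j ∈ range (n + 1 + 1), (-1 : ℚ_[2]) ^ j * ((n + 1).choose j : ℚ_[2]) = 0 := by
    exact_mod_cast Int.alternating_sum_range_choose_of_ne (n := n + 1) (by omega)
  have h3 : ∑ j ∈ (range (n + 1 + 1)).filter Odd, ((n + 1).choose j : ℚ_[2]) = 2 ^ n := by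
    have h4 : 2 * ∑ j ∈ (range (n + 1 + 1)).filter Odd, ((n + 1).choose j : ℚ_[2])
        = 2 * 2 ^ n := by
      rw [← pow_succ', ← h1, ← sub_zero (∑ j ∈ range (n + 1 + 1), _), ← h2, ← sum_sub_distrib,
        sum_filter, mul_sum]
      refine sum_congr rfl fun j _ => ?_
      split_ifs with hj
      · rw [hj.neg_one_pow]; ring
      · rw [(Nat.not_odd_iff_even.1 hj).neg_one_pow]; ring
    exact mul_left_cancel₀ two_ne_zero h4
  simp [oddSum, h3]
  ring

theorem norm_two_pow (n : ℕ) : ‖(2 : ℚ_[2]) ^ n‖ = (2 : ℝ) ^ (-(n : ℤ)) := by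
  simpa using Padic.norm_p_pow (p := 2) n

theorem norm_natCast_eq {n : ℕ} (hn : n ≠ 0) :
    ‖(n : ℚ_[2])‖ = (2 : ℝ) ^ (-(padicValNat 2 n : ℤ)) := by
  have h : (n : ℚ_[2]) ≠ 0 := by exact_mod_cast hn
  rw [Padic.norm_eq_zpow_neg_valuation h, Padic.valuation_natCast]
  norm_num

/-- By Legendre ν((n+1)!) ≤ n, so the power 2^n absorbs the factorial. -/
theorem norm_oddSum_one_le (n : ℕ) : ‖oddSum n (fun _ => 1)‖ ≤ 1 := by
  cases n with
  | zero => simp [oddSum_zero]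
  | succ n =>
    rw [oddSum_one, norm_div, norm_two_pow, norm_natCast_eq (Nat.factorial_ne_zero _),
      ← zpow_sub₀ two_ne_zero]
    have h := sub_one_mul_padicValNat_factorial_lt_of_ne_zero 2 (n := n + 1) (by omega)
    refine zpow_le_one_of_nonpos₀ one_le_two ?_
    omega

theorem norm_oddSum_pow_le (x n : ℕ) : ‖oddSum n (fun j => (j : ℚ_[2]) ^ x)‖ ≤ 1 := by
  induction x generalizing n with
  | zero => simpa using norm_oddSum_one_le n
  | succ x ih =>
    cases n with
    | zero => simp [oddSum_zero]
    | succ n =>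
      simp only [pow_succ']
      rw [oddSum_succ_mul]
      refine padic_norm_sub_le ?_ (ih n)
      rw [norm_mul]
      refine mul_le_one₀ ?_ (norm_nonneg _) (ih _)
      exact_mod_cast norm_natCast_le_one (n + 1)

open Polynomial in
theorem norm_oddSum_eval_le (n : ℕ) (q : ℤ[X]) :
    ‖oddSum n (fun j => ((q.eval (j : ℤ) : ℤ) : ℚ_[2]))‖ ≤ 1 := by
  have h : (fun j : ℕ => ((q.eval (j : ℤ) : ℤ) : ℚ_[2])) =
      fun j : ℕ => ∑ i ∈ range (q.natDegree + 1), (q.coeff i : ℚ_[2]) * (j : ℚ_[2]) ^ i := by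
    ext j
    rw [eval_eq_sum_range]
    push_cast
    rfl
  rw [h, oddSum_sum]
  refine padic_norm_sum_le zero_le_one fun i _ => ?_
  rw [oddSum_const_mul, norm_mul]
  exact mul_le_one₀ (Padic.norm_int_le_one _) (norm_nonneg _) (norm_oddSum_pow_le i n)

/-! ### Newton polynomials at the odd integers -/

/-- The Newton basis polynomial `(X - 1) (X - 3) ⋯ (X - (2 k - 1))`. -/
noncomputable def oddNewton (k : ℕ) : Polynomial ℤ :=
  ∏ i ∈ range k, (Polynomial.X - (1 + 2 * (i : Polynomial ℤ)))

theorem oddNewton_succ (k : ℕ) :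
    oddNewton (k + 1) = oddNewton k * (Polynomial.X - (1 + 2 * (k : Polynomial ℤ))) := by
  simp [oddNewton, prod_range_succ]

theorem oddNewton_eval_succ (k : ℕ) (y : ℤ) :
    (oddNewton (k + 1)).eval y = (oddNewton k).eval y * (y - (1 + 2 * k)) := by
  simp [oddNewton_succ]

theorem oddNewton_eval (k i : ℕ) :
    (oddNewton k).eval ((2 * i + 1 : ℕ) : ℤ) = 2 ^ k * k.factorial * i.choose k := by
  induction k with
  | zero => simp [oddNewton]
  | succ k ih =>
    rw [oddNewton_eval_succ, ih]
    have h : ((i.choose (k + 1) : ℕ) : ℤ) * (k + 1) = i.choose k * (i - k) := by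
      rcases le_or_gt k i with hk | hk
      · have := Nat.choose_succ_right_eq i k
        rw [← Nat.cast_sub hk]
        exact_mod_cast this
      · rw [Nat.choose_eq_zero_of_lt hk, Nat.choose_eq_zero_of_lt (by omega)]
        simp
    rw [Nat.factorial_succ]
    push_cast
    linear_combination (-(2 : ℤ) ^ (k + 1) * k.factorial) * h

theorem oddSum_mul_oddNewton_eq_zero {n k : ℕ} (h : n ≤ 2 * k) (g : ℕ → ℚ_[2]) :
    oddSum n (fun j => g j * (((oddNewton k).eval (j : ℤ) : ℤ) : ℚ_[2])) = 0 := by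
  unfold oddSum
  rw [sum_eq_zero, mul_zero]
  intro j hj
  rw [mem_filter, mem_range] at hj
  obtain ⟨i, rfl⟩ := hj.2
  simp only [oddNewton_eval, Nat.choose_eq_zero_of_lt (show i < k by omega)]
  simp

/-! ### 2-adic norm facts -/

theorem norm_sub_one_le_half {z : ℚ_[2]} (hz : ‖z‖ = 1) : ‖z - 1‖ ≤ 2⁻¹ := by
  set w : ℤ_[2] := ⟨z, hz.le⟩ with hw
  obtain ⟨n, hn, h⟩ := PadicInt.exists_mem_range w
  have h' : ‖w - n‖ < 1 := by
    rwa [IsLocalRing.mem_maximalIdeal, PadicInt.mem_nonunits] at h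
  have h2 : ‖z - (n : ℚ_[2])‖ < 1 := by
    rwa [PadicInt.norm_def, PadicInt.coe_sub, PadicInt.coe_natCast] at h'
  have h3 : ‖z - 1‖ < 1 := by
    interval_cases n
    · simp [hz] at h2
    · simpa using h2
  have := (Padic.norm_le_pow_iff_norm_lt_pow_add_one (p := 2) (z - 1) (-1)).2 (by simpa using h3)
  simpa using this

/-- The residue field has a single nonzero element, so leading digits of equal order cancel. -/
theorem norm_add_le_of_norm_eq {a b : ℚ_[2]} {k : ℕ} (ha : ‖a‖ = (2 : ℝ) ^ (-(k : ℤ)))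
    (hb : ‖b‖ = (2 : ℝ) ^ (-(k : ℤ))) : ‖a + b‖ ≤ (2 : ℝ) ^ (-((k + 1 : ℕ) : ℤ)) := by
  have hb0 : b ≠ 0 := by
    intro h
    rw [h, norm_zero] at hb
    exact (zpow_pos two_pos _).ne hb
  have h1 : ‖-(a / b)‖ = 1 := by
    rw [norm_neg, norm_div, ha, hb, div_self (zpow_pos two_pos _).ne']
  have h2 : a + b = -b * (-(a / b) - 1) := by field_simp; ring
  rw [h2, norm_mul, norm_neg, hb]
  calc _ ≤ (2 : ℝ) ^ (-(k : ℤ)) * 2⁻¹ := by gcongr; exact norm_sub_one_le_half h1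
    _ = _ := by
      push_cast
      rw [neg_add, zpow_add₀ two_ne_zero, zpow_neg_one]

theorem norm_add_eq_left {a b : ℚ_[2]} (h : ‖b‖ < ‖a‖) : ‖a + b‖ = ‖a‖ := by
  rw [Padic.add_eq_max_of_ne h.ne', max_eq_left h.le]

theorem norm_natCast_odd {n : ℕ} (hn : Odd n) : ‖(n : ℚ_[2])‖ = 1 := by
  rw [norm_natCast_eq (by rintro rfl; simp at hn), padicValNat.eq_zero_of_not_dvd]
  · simp
  · exact hn.not_two_dvd_nat

theorem norm_natCast_le_of_dvd {n k : ℕ} (h : 2 ^ k ∣ n) :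
    ‖(n : ℚ_[2])‖ ≤ (2 : ℝ) ^ (-(k : ℤ)) := by
  have := (Padic.norm_int_le_pow_iff_dvd (p := 2) (n : ℤ) k).2 (by exact_mod_cast h)
  exact_mod_cast this

theorem norm_natCast_even {n : ℕ} (hn : Even n) : ‖(n : ℚ_[2])‖ ≤ 2⁻¹ := by
  simpa using norm_natCast_le_of_dvd (k := 1) (by simpa using hn.two_dvd)

/-! ### Parity of the moments -/

/-- The functional `oddSum n` at `X ^ x * oddNewton k`. -/
noncomputable def oddMoment (n k x : ℕ) : ℚ_[2] :=
  oddSum n (fun j => (j : ℚ_[2]) ^ x * (((oddNewton k).eval (j : ℤ) : ℤ) : ℚ_[2]))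

theorem oddMoment_eq_zero {n k : ℕ} (h : n ≤ 2 * k) (x : ℕ) : oddMoment n k x = 0 :=
  oddSum_mul_oddNewton_eq_zero h _

theorem oddMoment_succ (n k x : ℕ) :
    oddMoment (n + 1) k (x + 1) = (n + 1) * oddMoment (n + 1) k x - oddMoment n k x := by
  unfold oddMoment
  rw [← oddSum_succ_mul]
  exact oddSum_congr fun j _ _ => by ring

theorem oddMoment_succ_newton (n k x : ℕ) :
    oddMoment n (k + 1) x = oddMoment n k (x + 1) - (1 + 2 * k) * oddMoment n k x := by
  unfold oddMoment
  rw [← oddSum_const_mul, ← oddSum_sub]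
  refine oddSum_congr fun j _ _ => ?_
  rw [oddNewton_eval_succ]
  push_cast
  ring

theorem norm_oddMoment_le (n k x : ℕ) : ‖oddMoment n k x‖ ≤ 1 := by
  have := norm_oddSum_eval_le n (Polynomial.X ^ x * oddNewton k)
  simpa [oddMoment] using this

/-- The moment at n = 2k vanishes, so the recurrence reduces to multiplication by 2k + 1. -/
theorem oddMoment_top (k x : ℕ) :
    oddMoment (2 * k + 1) k x = (2 * k + 1) ^ x * oddMoment (2 * k + 1) k 0 := by
  induction x with
  | zero => simp
  | succ x ih =>
    rw [oddMoment_succ, oddMoment_eq_zero le_rfl, ih]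
    push_cast
    ring

theorem oddMoment_two_mul_add_two (k x : ℕ) :
    oddMoment (2 * k + 2) k x = oddMoment (2 * k + 1) k x := by
  have h1 := oddMoment_succ_newton (2 * k + 2) k x
  have h2 := oddMoment_succ (2 * k + 1) k x
  rw [oddMoment_eq_zero (by omega)] at h1
  push_cast at h2
  rw [show 2 * k + 1 + 1 = 2 * k + 2 by ring] at h2
  linear_combination -h1 - h2

/-- Only the node 2k + 1 survives; the value is 1/(2k+1)!!, a 2-adic unit. -/
theorem oddMoment_top_zero (k : ℕ) :
    oddMoment (2 * k + 1) k 0 = 2 ^ k * k.factorial / ((2 * k + 1).factorial : ℚ_[2]) := by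
  unfold oddMoment oddSum
  rw [sum_eq_single_of_mem (2 * k + 1)]
  · beta_reduce
    rw [oddNewton_eval]
    simp
    ring
  · simp
  · intro j hj hne
    rw [mem_filter, mem_range] at hj
    obtain ⟨i, rfl⟩ := hj.2
    simp only [oddNewton_eval, Nat.choose_eq_zero_of_lt (show i < k by omega)]
    simp

theorem oddMoment_top_zero_succ (k : ℕ) :
    (2 * k + 3) * oddMoment (2 * k + 3) (k + 1) 0 = oddMoment (2 * k + 1) k 0 := by
  have h := oddMoment_top_zero (k + 1)
  rw [show 2 * (k + 1) + 1 = 2 * k + 3 by ring] at h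
  rw [h, oddMoment_top_zero]
  have h1 : ((2 * k + 1).factorial : ℚ_[2]) ≠ 0 := by exact_mod_cast Nat.factorial_ne_zero _
  have h2 : (2 * k + 1 + 1 : ℚ_[2]) ≠ 0 := by exact_mod_cast (2 * k + 1).succ_ne_zero
  have h3 : (2 * k + 3 : ℚ_[2]) ≠ 0 := by exact_mod_cast (2 * k + 2).succ_ne_zero
  have h4 : ((2 * k + 3).factorial : ℚ_[2]) =
      (2 * k + 3) * ((2 * k + 1 + 1) * (2 * k + 1).factorial) := by
    rw [Nat.factorial_succ, Nat.factorial_succ]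
    push_cast
    ring
  rw [h4, Nat.factorial_succ]
  push_cast
  field_simp
  ring

theorem norm_two_mul_add_one (k : ℕ) : ‖(2 * k + 1 : ℚ_[2])‖ = 1 := by
  exact_mod_cast norm_natCast_odd (n := 2 * k + 1) (by simp)

theorem norm_two_mul_add_three (k : ℕ) : ‖(2 * k + 3 : ℚ_[2])‖ = 1 := by
  exact_mod_cast norm_natCast_odd (n := 2 * k + 3) ⟨k + 1, by ring⟩

theorem norm_oddMoment_top_zero (k : ℕ) : ‖oddMoment (2 * k + 1) k 0‖ = 1 := by
  induction k with
  | zero =>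
    rw [oddMoment_top_zero]
    simp
  | succ k ih =>
    have h := congrArg norm (oddMoment_top_zero_succ k)
    rw [ih, norm_mul, norm_two_mul_add_three, one_mul] at h
    exact h

theorem norm_oddMoment_top (k x : ℕ) : ‖oddMoment (2 * k + 1) k x‖ = 1 := by
  rw [oddMoment_top, norm_mul, norm_pow, norm_oddMoment_top_zero, norm_two_mul_add_one]
  simp

theorem oddMoment_two_mul_add_three_zero (k : ℕ) :
    (2 * k + 3) * oddMoment (2 * k + 3) k 0 = (k + 2) * oddMoment (2 * k + 1) k 0 := by
  have h1 := oddMoment_succ_newton (2 * k + 3) k 0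
  have h2 := oddMoment_succ (2 * k + 2) k 0
  have h3 := oddMoment_two_mul_add_two k 0
  have h4 := oddMoment_top_zero_succ k
  push_cast at h2
  rw [show 2 * k + 2 + 1 = 2 * k + 3 by ring] at h2
  refine mul_left_cancel₀ (two_ne_zero (α := ℚ_[2])) ?_
  linear_combination h4 - (2 * (k : ℚ_[2]) + 3) * (h1 + h2 - h3)

/-- Modulo 2 the recurrence says that raising x by one adds 1, so the parity alternates. The value
at x = 0 is (k+2)/(2k+3) times a unit, which is even because k is. -/
theorem norm_oddMoment_two_mul_add_three {k : ℕ} (hk : Even k) (x : ℕ) :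
    (Even x → ‖oddMoment (2 * k + 3) k x‖ ≤ 2⁻¹) ∧ (Odd x → ‖oddMoment (2 * k + 3) k x‖ = 1) := by
  induction x with
  | zero =>
    refine ⟨fun _ => ?_, by simp⟩
    have h := congrArg norm (oddMoment_two_mul_add_three_zero k)
    rw [norm_mul, norm_mul, norm_two_mul_add_three, norm_oddMoment_top_zero, one_mul, mul_one] at h
    rw [h]
    exact_mod_cast norm_natCast_even (n := k + 2) (hk.add (by decide))
  | succ x ih =>
    have h := oddMoment_succ (2 * k + 2) k x
    push_cast at h
    rw [show (2 * k + 2 + 1 : ℚ_[2]) = 2 * k + 3 by ring, show 2 * k + 2 + 1 = 2 * k + 3 by ring,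
      oddMoment_two_mul_add_two] at h
    have hb : ‖-oddMoment (2 * k + 1) k x‖ = 1 := by rw [norm_neg, norm_oddMoment_top]
    refine ⟨fun hx => ?_, fun hx => ?_⟩
    · have hx' := ih.2 (by simpa [Nat.even_add_one] using hx)
      rw [h, sub_eq_add_neg]
      have := norm_add_le_of_norm_eq (k := 0) (a := (2 * k + 3) * oddMoment (2 * k + 3) k x)
        (b := -oddMoment (2 * k + 1) k x)
        (by rw [norm_mul, norm_two_mul_add_three]; simpa using hx') (by simpa using hb)
      simpa only [Nat.cast_one, zpow_neg_one, zero_add] using this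
    · have hx' := ih.1 (by simpa [Nat.odd_add_one] using hx)
      rw [h, sub_eq_add_neg, add_comm, norm_add_eq_left, hb]
      rw [hb, norm_mul, norm_two_mul_add_three, one_mul]
      linarith

/-- The factor 2k + 4 in the recurrence is even, so modulo 2 only the moment at 2k + 3 with the
preceding, odd exponent remains. The exponent 0 has no predecessor. -/
theorem norm_oddMoment_two_mul_add_four {k : ℕ} (hk : Even k) {x : ℕ} (hx : Even x) (h0 : x ≠ 0) :
    ‖oddMoment (2 * k + 4) k x‖ = 1 := by
  obtain ⟨x, rfl⟩ := Nat.exists_eq_succ_of_ne_zero h0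
  have hx' : Odd x := by
    by_contra h
    simp [Nat.even_add_one] at hx
    exact h hx
  have h := oddMoment_succ (2 * k + 3) k x
  have hb : ‖-oddMoment (2 * k + 3) k x‖ = 1 := by
    rw [norm_neg, (norm_oddMoment_two_mul_add_three hk x).2 hx']
  rw [show 2 * k + 4 = 2 * k + 3 + 1 by ring, Nat.succ_eq_add_one, h, sub_eq_add_neg, add_comm,
    norm_add_eq_left, hb]
  rw [hb, norm_mul]
  have h2 : ‖(((2 * k + 3 : ℕ) : ℚ_[2]) + 1)‖ ≤ 2⁻¹ := by
    exact_mod_cast norm_natCast_even (n := 2 * k + 3 + 1) ⟨k + 2, by ring⟩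
  have h3 := norm_oddMoment_le (2 * k + 3 + 1) k x
  nlinarith [norm_nonneg (oddMoment (2 * k + 3 + 1) k x)]

/-! ### Powers of X^2 - 1 modulo 2 -/

open Polynomial in
theorem exists_sq_sub_one_pow_eq (q : ℕ) :
    ∃ r : ℤ[X], (X ^ 2 - 1) ^ q = oddNewton (2 * q) + 2 * r := by
  induction q with
  | zero => exact ⟨0, by simp [oddNewton]⟩
  | succ q ih =>
    obtain ⟨r, hr⟩ := ih
    -- The linear factor is half of (X^2 - 1) - (X - (4q+1))(X - (4q+3)).
    refine ⟨r * (X ^ 2 - 1) + oddNewton (2 * q) *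
      ((2 + 4 * (q : ℤ[X])) * X - (2 + 8 * (q : ℤ[X]) + 8 * (q : ℤ[X]) ^ 2)), ?_⟩
    rw [pow_succ, hr, show 2 * (q + 1) = 2 * q + 1 + 1 by ring, oddNewton_succ, oddNewton_succ]
    push_cast
    ring

theorem norm_oddSum_sq_sub_one_sub_oddMoment_le (n q x : ℕ) :
    ‖oddSum n (fun j => (j : ℚ_[2]) ^ x * ((j : ℚ_[2]) ^ 2 - 1) ^ q) - oddMoment n (2 * q) x‖
      ≤ 2⁻¹ := by
  obtain ⟨r, hr⟩ := exists_sq_sub_one_pow_eq q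
  have h : oddSum n (fun j => (j : ℚ_[2]) ^ x * ((j : ℚ_[2]) ^ 2 - 1) ^ q) - oddMoment n (2 * q) x
      = 2 * oddSum n (fun j => (((Polynomial.X ^ x * r).eval (j : ℤ) : ℤ) : ℚ_[2])) := by
    unfold oddMoment
    rw [← oddSum_sub, ← oddSum_const_mul]
    refine oddSum_congr fun j _ _ => ?_
    have := congrArg (fun p : Polynomial ℤ => ((p.eval (j : ℤ) : ℤ) : ℚ_[2])) hr
    simp at this
    simp [this]
    ring
  rw [h, norm_mul]
  have h2 : ‖(2 : ℚ_[2])‖ = 2⁻¹ := by simpa using norm_two_pow 1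
  rw [h2]
  exact mul_le_of_le_one_right (by norm_num) (norm_oddSum_eval_le _ _)

theorem norm_oddSum_sq_sub_one_le (n q x : ℕ) :
    ‖oddSum n (fun j => (j : ℚ_[2]) ^ x * ((j : ℚ_[2]) ^ 2 - 1) ^ q)‖ ≤ 1 := by
  have := norm_oddSum_eval_le n (Polynomial.X ^ x * (Polynomial.X ^ 2 - 1) ^ q)
  simpa using this

/-! ### Increments when the exponent grows by 2^(e-1+m) -/

theorem norm_choose_two_pow {s j : ℕ} (hj : j ≠ 0) (hjs : j ≤ 2 ^ s) :
    ‖((2 ^ s).choose j : ℚ_[2])‖ = (2 : ℝ) ^ (-((s : ℤ) - padicValNat 2 j)) := by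
  have h := Nat.factorization_choose_prime_pow_add_factorization Nat.prime_two hjs hj
  rw [Nat.factorization_def _ Nat.prime_two, Nat.factorization_def _ Nat.prime_two] at h
  rw [norm_natCast_eq (Nat.choose_pos hjs).ne']
  congr 1
  omega

/-- Legendre's ν(k!) < k suffices up to k = 2^(e-1). The last k is odd, so its factorial gains no
further factor 2. -/
theorem padicValNat_two_pow_mul_factorial_le {e k : ℕ} (he : 2 ≤ e) (hk : k ≤ 2 ^ (e - 1) + 1) :
    k + padicValNat 2 k.factorial ≤ 2 ^ e := by
  obtain ⟨e, rfl⟩ := Nat.exists_eq_add_of_le' he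
  have h2 : (2 : ℕ) ^ (e + 2) = 2 * 2 ^ (e + 1) := by ring
  simp only [show e + 2 - 1 = e + 1 by omega] at hk
  have h1 := sub_one_mul_padicValNat_factorial_lt_of_ne_zero 2 (n := 2 ^ (e + 1)) (by positivity)
  rcases Nat.lt_or_ge k (2 ^ (e + 1) + 1) with h | h
  · rcases Nat.eq_zero_or_pos k with rfl | h0
    · simp
    · have h3 := sub_one_mul_padicValNat_factorial_lt_of_ne_zero 2 (n := k) (by omega)
      omega
  · obtain rfl : k = 2 ^ (e + 1) + 1 := le_antisymm hk h
    rw [Nat.factorial_succ, padicValNat.mul (by omega) (Nat.factorial_ne_zero _),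
      padicValNat.eq_zero_of_not_dvd (n := 2 ^ (e + 1) + 1)]
    · omega
    · rw [pow_succ]; omega

-- Newton interpolation of i ↦ g(2i + 1): the differences are bounded by r, the moments are
-- integral, and dividing by 2^k k! costs at most 2^(2^e).
open fwdDiff in
theorem norm_oddSum_le {e n : ℕ} (he : 2 ≤ e) (hn : n ≤ 2 ^ e + 4) {g : ℕ → ℚ_[2]} {r : ℝ}
    (hr : 0 ≤ r) (hg : ∀ j, Odd j → ‖g j‖ ≤ r) : ‖oddSum n g‖ ≤ r * 2 ^ (2 ^ e) := by
  -- Odd j ≤ 2^e + 4 are j = 2i + 1 with i ≤ 2^(e-1) + 1.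
  set K := 2 ^ (e - 1) + 2 with hK
  have hKe : 2 ^ e = 2 * 2 ^ (e - 1) := by
    rw [← pow_succ']; congr 1; omega
  set d : ℕ → ℚ_[2] := fun k => (fwdDiff 1)^[k] (fun i : ℕ => g (2 * i + 1)) 0 with hd
  have hdr : ∀ k, ‖d k‖ ≤ r := by
    intro k
    simp only [hd]
    rw [fwdDiff_iter_eq_sum_shift]
    refine padic_norm_sum_le hr fun i _ => ?_
    rw [zsmul_eq_mul, norm_mul]
    exact (mul_le_of_le_one_left (norm_nonneg _) (Padic.norm_int_le_one _)).trans
      (hg _ (by simp))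
  have h : oddSum n g = ∑ k ∈ range K, (d k / ((2 ^ k * k.factorial : ℕ) : ℚ_[2])) *
      oddMoment n k 0 := by
    simp only [oddMoment, ← oddSum_const_mul]
    rw [← oddSum_sum]
    refine oddSum_congr fun j hj hjn => ?_
    obtain ⟨i, rfl⟩ := hj
    have h1 := shift_eq_sum_fwdDiff_iter 1 (fun i : ℕ => g (2 * i + 1)) i 0
    simp only [zero_add, smul_eq_mul, mul_one] at h1
    rw [h1]
    rw [sum_subset (range_mono (show i + 1 ≤ K by omega))]
    · refine sum_congr rfl fun k _ => ?_
      rw [oddNewton_eval]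
      have hk : (k.factorial : ℚ_[2]) ≠ 0 := by exact_mod_cast k.factorial_ne_zero
      simp only [hd]
      push_cast
      rw [nsmul_eq_mul]
      field_simp
    · intro k _ hk
      rw [mem_range] at hk
      rw [Nat.choose_eq_zero_of_lt (by omega), zero_smul]
  rw [h]
  refine padic_norm_sum_le (by positivity) fun k hk => ?_
  rw [mem_range] at hk
  rw [norm_mul, norm_div]
  refine (mul_le_of_le_one_right (by positivity) (norm_oddMoment_le n k 0)).trans ?_
  rw [norm_natCast_eq (Nat.mul_pos (by positivity) k.factorial_pos).ne', div_eq_mul_inv,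
    ← zpow_neg, neg_neg]
  refine mul_le_mul (hdr k) ?_ (by positivity) hr
  rw [padicValNat.mul (by positivity) (Nat.factorial_ne_zero _), padicValNat.prime_pow,
    zpow_natCast]
  exact pow_le_pow_right₀ one_le_two (padicValNat_two_pow_mul_factorial_le he (by omega))

theorem norm_sq_sub_one_le {j : ℕ} (hj : Odd j) : ‖(j : ℚ_[2]) ^ 2 - 1‖ ≤ (2 : ℝ) ^ (-3 : ℤ) := by
  have h : (8 : ℤ) ∣ (j : ℤ) ^ 2 - 1 := Int.eight_dvd_sq_sub_one_of_odd (by exact_mod_cast hj)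
  have := (Padic.norm_int_le_pow_iff_dvd (p := 2) ((j : ℤ) ^ 2 - 1) 3).2 (by simpa using h)
  exact_mod_cast this

theorem norm_oddSum_sq_sub_one_le_zpow {e n : ℕ} (he : 2 ≤ e) (hn : n ≤ 2 ^ e + 4) (x q : ℕ) :
    ‖oddSum n (fun j => (j : ℚ_[2]) ^ x * ((j : ℚ_[2]) ^ 2 - 1) ^ q)‖ ≤
      (2 : ℝ) ^ (((2 ^ e : ℕ) : ℤ) - 3 * q) := by
  have := norm_oddSum_le he hn (g := fun j => (j : ℚ_[2]) ^ x * ((j : ℚ_[2]) ^ 2 - 1) ^ q)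
    (r := (2 : ℝ) ^ (-3 * q : ℤ)) (by positivity) ?_
  · refine this.trans_eq ?_
    rw [sub_eq_neg_add, zpow_add₀ two_ne_zero, zpow_natCast]
    simp
  · intro j hj
    rw [norm_mul, norm_pow, norm_pow, norm_natCast_odd hj, one_pow, one_mul, zpow_mul, zpow_natCast]
    exact pow_le_pow_left₀ (norm_nonneg _) (norm_sq_sub_one_le hj) _

/-- If ν(j) < e - 2, the binomial coefficient alone has valuation above m. Otherwise j is at least
twice 2^(e-2), so 2^e ≤ 2j, and the divisibility of (y^2 - 1)^j by 8^j gives at least 3j - 2^e ≥ j >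
ν(j), outweighing the loss in the binomial coefficient. -/
theorem norm_choose_mul_oddSum_le {e n : ℕ} (he : 2 ≤ e) (hn : n ≤ 2 ^ e + 4) (m x : ℕ) {j : ℕ}
    (hj : j ≠ 0) (hjm : j ≤ 2 ^ (e - 2 + m)) (hje : j ≠ 2 ^ (e - 2)) :
    ‖((2 ^ (e - 2 + m)).choose j : ℚ_[2]) *
      oddSum n (fun y => (y : ℚ_[2]) ^ x * ((y : ℚ_[2]) ^ 2 - 1) ^ j)‖ ≤
        (2 : ℝ) ^ (-((m + 1 : ℕ) : ℤ)) := by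
  rw [norm_mul, norm_choose_two_pow hj hjm]
  rcases Nat.lt_or_ge (padicValNat 2 j) (e - 2) with h | h
  · refine (mul_le_of_le_one_right (by positivity) (norm_oddSum_sq_sub_one_le n j x)).trans ?_
    refine zpow_le_zpow_right₀ one_le_two ?_
    omega
  · refine (mul_le_mul_of_nonneg_left (norm_oddSum_sq_sub_one_le_zpow he hn x j)
      (by positivity)).trans ?_
    rw [← zpow_add₀ two_ne_zero]
    refine zpow_le_zpow_right₀ one_le_two ?_
    obtain ⟨t, ht⟩ : 2 ^ (e - 2) ∣ j := (pow_dvd_pow 2 h).trans pow_padicValNat_dvd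
    have h2 : 2 ≤ t := by
      by_contra h'
      interval_cases t <;> simp_all
    have h3 : 2 ^ e = 4 * 2 ^ (e - 2) := by
      rw [show (4 : ℕ) = 2 ^ 2 by norm_num, ← pow_add]; congr 1; omega
    have h4 : 2 ^ e ≤ 2 * j := by
      rw [ht, h3]; nlinarith [Nat.pos_of_neZero (2 ^ (e - 2))]
    have h5 : padicValNat 2 j < j :=
      Nat.lt_two_pow_self.trans_le (Nat.le_of_dvd (Nat.pos_of_ne_zero hj) pow_padicValNat_dvd)
    generalize padicValNat 2 j = v at h h5 ⊢
    generalize 2 ^ e = N at h4 ⊢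
    omega

theorem pow_two_pow_sub_eq_sum {e : ℕ} (he : 2 ≤ e) (m : ℕ) (y : ℚ_[2]) :
    y ^ 2 ^ (e - 1 + m) = ∑ j ∈ range (2 ^ (e - 2 + m) + 1),
      ((2 ^ (e - 2 + m)).choose j : ℚ_[2]) * (y ^ 2 - 1) ^ j := by
  have h : (2 : ℕ) ^ (e - 1 + m) = 2 * 2 ^ (e - 2 + m) := by
    rw [← pow_succ']; congr 1; omega
  rw [h, pow_mul]
  conv_lhs => rw [← sub_add_cancel (y ^ 2) 1]
  rw [add_pow]
  refine sum_congr rfl fun j _ => ?_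
  rw [one_pow]
  ring

theorem norm_oddSum_pow_diff_sub_le {e n : ℕ} (he : 2 ≤ e) (hn : n ≤ 2 ^ e + 4) (m x : ℕ) :
    ‖oddSum n (fun y => (y : ℚ_[2]) ^ (x + 2 ^ (e - 1 + m))) - oddSum n (fun y => (y : ℚ_[2]) ^ x) -
      ((2 ^ (e - 2 + m)).choose (2 ^ (e - 2)) : ℚ_[2]) * oddMoment n (2 ^ (e - 1)) x‖ ≤
        (2 : ℝ) ^ (-((m + 1 : ℕ) : ℤ)) := by
  set Q := 2 ^ (e - 2 + m) with hQ
  set S : ℕ → ℚ_[2] := fun j => (Q.choose j : ℚ_[2]) *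
      oddSum n (fun y => (y : ℚ_[2]) ^ x * ((y : ℚ_[2]) ^ 2 - 1) ^ j) with hS
  have h1 : oddSum n (fun y => (y : ℚ_[2]) ^ (x + 2 ^ (e - 1 + m))) = ∑ j ∈ range (Q + 1), S j := by
    simp only [hS, ← oddSum_const_mul]
    rw [← oddSum_sum]
    refine oddSum_congr fun y _ _ => ?_
    rw [pow_add, pow_two_pow_sub_eq_sum he, mul_sum]
    refine sum_congr rfl fun j _ => by ring
  have hle : 2 ^ (e - 2) ≤ Q := Nat.pow_le_pow_right two_pos (by omega)
  have hpos : 0 < 2 ^ (e - 2) := by positivity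
  have h0 : S 0 = oddSum n (fun y => (y : ℚ_[2]) ^ x) := by simp [hS]
  -- The term j = 0 cancels the value at x; the remaining indices are shifted by one, so the main
  -- term sits at 2^(e-2) - 1.
  rw [h1, sum_range_succ', h0, add_sub_cancel_right,
    ← add_sum_erase _ _ (show 2 ^ (e - 2) - 1 ∈ range Q by rw [mem_range]; omega),
    show 2 ^ (e - 2) - 1 + 1 = 2 ^ (e - 2) by omega, add_sub_right_comm]
  refine padic_norm_add_le ?_ (padic_norm_sum_le (by positivity) fun j hj => ?_)
  · simp only [hS, ← mul_sub]
    rw [norm_mul, norm_choose_two_pow hpos.ne' hle, padicValNat.prime_pow,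
      show 2 ^ (e - 1) = 2 * 2 ^ (e - 2) by rw [← pow_succ']; congr 1; omega]
    refine (mul_le_mul_of_nonneg_left (norm_oddSum_sq_sub_one_sub_oddMoment_le n _ x)
      (by positivity)).trans ?_
    rw [← zpow_neg_one, ← zpow_add₀ two_ne_zero]
    refine zpow_le_zpow_right₀ one_le_two ?_
    push_cast
    omega
  · rw [mem_erase, mem_range] at hj
    exact norm_choose_mul_oddSum_le he hn m x (by omega) (by omega) (by omega)

theorem norm_choose_two_pow_two_pow (s m : ℕ) :
    ‖((2 ^ (s + m)).choose (2 ^ s) : ℚ_[2])‖ = (2 : ℝ) ^ (-(m : ℤ)) := by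
  rw [norm_choose_two_pow (by positivity) (Nat.pow_le_pow_right two_pos (by omega)),
    padicValNat.prime_pow]
  congr 1
  push_cast
  ring

theorem zpow_neg_succ_lt (m : ℕ) : (2 : ℝ) ^ (-((m + 1 : ℕ) : ℤ)) < (2 : ℝ) ^ (-(m : ℤ)) :=
  zpow_lt_zpow_right₀ one_lt_two (by push_cast; omega)

theorem norm_oddSum_pow_diff_le {e n : ℕ} (he : 2 ≤ e) (hn : n ≤ 2 ^ e + 4) (m x : ℕ) :
    ‖oddSum n (fun y => (y : ℚ_[2]) ^ (x + 2 ^ (e - 1 + m))) - oddSum n (fun y => (y : ℚ_[2]) ^ x)‖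
      ≤ (2 : ℝ) ^ (-(m : ℤ)) := by
  rw [← sub_add_cancel (_ - _) (((2 ^ (e - 2 + m)).choose (2 ^ (e - 2)) : ℚ_[2]) *
    oddMoment n (2 ^ (e - 1)) x)]
  refine padic_norm_add_le
    ((norm_oddSum_pow_diff_sub_le he hn m x).trans (zpow_neg_succ_lt m).le) ?_
  rw [norm_mul, norm_choose_two_pow_two_pow]
  exact mul_le_of_le_one_right (by positivity) (norm_oddMoment_le _ _ _)

theorem norm_oddSum_pow_diff_eq {e n : ℕ} (he : 2 ≤ e) (hn : n ≤ 2 ^ e + 4) (m x : ℕ)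
    (hx : ‖oddMoment n (2 ^ (e - 1)) x‖ = 1) :
    ‖oddSum n (fun y => (y : ℚ_[2]) ^ (x + 2 ^ (e - 1 + m))) - oddSum n (fun y => (y : ℚ_[2]) ^ x)‖
      = (2 : ℝ) ^ (-(m : ℤ)) := by
  have h : ‖((2 ^ (e - 2 + m)).choose (2 ^ (e - 2)) : ℚ_[2]) * oddMoment n (2 ^ (e - 1)) x‖ =
      (2 : ℝ) ^ (-(m : ℤ)) := by
    rw [norm_mul, norm_choose_two_pow_two_pow, hx, mul_one]
  rw [← sub_add_cancel (_ - _) (((2 ^ (e - 2 + m)).choose (2 ^ (e - 2)) : ℚ_[2]) *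
    oddMoment n (2 ^ (e - 1)) x), add_comm, norm_add_eq_left, h]
  rw [h]
  exact (norm_oddSum_pow_diff_sub_le he hn m x).trans_lt (zpow_neg_succ_lt m)

/-! ### Reflection j ↦ n - j -/

theorem oddSum_reflect {n : ℕ} (hn : Even n) (g : ℕ → ℚ_[2]) :
    oddSum n (fun j => g (n - j)) = oddSum n g := by
  unfold oddSum
  congr 1
  have hmem : ∀ j ∈ (range (n + 1)).filter Odd, n - j ∈ (range (n + 1)).filter Odd := by
    intro j hj
    rw [mem_filter, mem_range] at hj ⊢
    exact ⟨by omega, Nat.Even.sub_odd (by omega) hn hj.2⟩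
  refine sum_nbij' (fun j => n - j) (fun j => n - j) hmem hmem ?_ ?_ ?_
  · intro j hj
    rw [mem_filter, mem_range] at hj
    omega
  · intro j hj
    rw [mem_filter, mem_range] at hj
    omega
  · intro j hj
    rw [mem_filter, mem_range] at hj
    rw [Nat.choose_symm (by omega)]

/-- The sum `G` such that `2 * oddSum n (· ^ x) = n * G` for even `n` and odd `x`. -/
noncomputable def reflectedSum (n x : ℕ) : ℚ_[2] :=
  ∑ i ∈ range x, (-1) ^ i * (n : ℚ_[2]) ^ i * (x.choose (i + 1) : ℚ_[2]) *
    oddSum n (fun j => (j : ℚ_[2]) ^ (x - 1 - i))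

/-- In the expansion of (n - j)^x the term free of n is -j^x, as x is odd; all others carry a factor
n. -/
theorem two_mul_oddSum_pow {n x : ℕ} (hn : Even n) (hx : Odd x) :
    2 * oddSum n (fun j => (j : ℚ_[2]) ^ x) = n * reflectedSum n x := by
  have h1 := oddSum_reflect hn (fun j => (j : ℚ_[2]) ^ x)
  have h2 : oddSum n (fun j => ((n - j : ℕ) : ℚ_[2]) ^ x) =
      ∑ i ∈ range (x + 1), ((n : ℚ_[2]) ^ i * (-1) ^ (x - i) * (x.choose i : ℚ_[2])) *
        oddSum n (fun j => (j : ℚ_[2]) ^ (x - i)) := by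
    simp only [← oddSum_const_mul]
    rw [← oddSum_sum]
    refine oddSum_congr fun j _ hj => ?_
    rw [Nat.cast_sub hj, sub_eq_add_neg, add_pow]
    refine sum_congr rfl fun i _ => ?_
    rw [neg_pow (j : ℚ_[2])]
    ring
  rw [h2, sum_range_succ'] at h1
  simp only [pow_zero, Nat.sub_zero, hx.neg_one_pow, Nat.choose_zero_right] at h1
  have h3 : ∑ i ∈ range x, ((n : ℚ_[2]) ^ (i + 1) * (-1) ^ (x - (i + 1)) *
      (x.choose (i + 1) : ℚ_[2])) * oddSum n (fun j => (j : ℚ_[2]) ^ (x - (i + 1))) =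
        n * reflectedSum n x := by
    rw [reflectedSum, mul_sum]
    refine sum_congr rfl fun i hi => ?_
    rw [mem_range] at hi
    have h4 : (-1 : ℚ_[2]) ^ (x - (i + 1)) = (-1) ^ i := by
      rw [neg_one_pow_congr]
      have := Nat.odd_iff.1 hx
      rw [Nat.even_iff, Nat.even_iff]
      omega
    rw [h4, show x - (i + 1) = x - 1 - i by omega]
    ring
  rw [h3] at h1
  push_cast at h1
  linear_combination -h1

theorem norm_reflectedSum_le (n x : ℕ) : ‖reflectedSum n x‖ ≤ 1 := by
  refine padic_norm_sum_le zero_le_one fun i _ => ?_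
  rw [norm_mul]
  refine mul_le_one₀ ?_ (norm_nonneg _) (norm_oddSum_pow_le _ _)
  have := Padic.norm_int_le_one (p := 2) ((-1) ^ i * (n : ℤ) ^ i * (x.choose (i + 1) : ℤ))
  exact_mod_cast this

/-- The falling factorial is an integer polynomial in x, hence compatible with congruence modulo
2^M. The factor n^i pays for the division by (i+1)!, whose valuation is at most i. -/
theorem norm_pow_mul_choose_sub_le {n : ℕ} (hn : 4 ∣ n) (x M i : ℕ) :
    ‖(n : ℚ_[2]) ^ i * (((x + 2 ^ M).choose (i + 1) : ℚ_[2]) - (x.choose (i + 1) : ℚ_[2]))‖ ≤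
      (2 : ℝ) ^ (-(M : ℤ)) := by
  have h1 : ((2 ^ M : ℕ) : ℤ) ∣ (((x + 2 ^ M).descFactorial (i + 1) : ℕ) : ℤ) -
      (x.descFactorial (i + 1) : ℕ) := by
    have := Polynomial.sub_dvd_eval_sub ((x + 2 ^ M : ℕ) : ℤ) (x : ℤ) (descPochhammer ℤ (i + 1))
    rw [descPochhammer_eval_eq_descFactorial, descPochhammer_eval_eq_descFactorial] at this
    simpa using this
  rw [Nat.descFactorial_eq_factorial_mul_choose, Nat.descFactorial_eq_factorial_mul_choose] at h1
  have h2 := (Padic.norm_int_le_pow_iff_dvd (p := 2) _ M).2 (by exact_mod_cast h1)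
  push_cast at h2
  rw [← mul_sub, norm_mul, norm_natCast_eq (Nat.factorial_ne_zero _)] at h2
  have h3 := sub_one_mul_padicValNat_factorial_lt_of_ne_zero 2 (n := i + 1) (by omega)
  have h4 : ‖(n : ℚ_[2]) ^ i‖ ≤ (2 : ℝ) ^ (-(padicValNat 2 (i + 1).factorial : ℤ)) := by
    have h5 : (2 : ℕ) ^ (2 * i) ∣ n ^ i := by
      rw [pow_mul]; exact pow_dvd_pow_of_dvd hn i
    have h6 := norm_natCast_le_of_dvd h5
    rw [Nat.cast_pow] at h6
    refine h6.trans (zpow_le_zpow_right₀ one_le_two ?_)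
    omega
  rw [norm_mul]
  exact (mul_le_mul_of_nonneg_right h4 (norm_nonneg _)).trans h2

theorem zpow_neg_succ_eq (m : ℕ) :
    (2 : ℝ) ^ (-((m + 1 : ℕ) : ℤ)) = 2⁻¹ * (2 : ℝ) ^ (-(m : ℤ)) := by
  rw [Nat.cast_add, neg_add, add_comm, zpow_add₀ two_ne_zero, Nat.cast_one, zpow_neg_one]

/-- Up to a multiple of 2^M, the term i = 0 changes by x times an increment at x - 1, of exact size
by `hmom`. In the other terms, a change in the binomial coefficient is controlled modulo 2^M, and a
change in the power sum gains a factor 2 from n. -/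
theorem norm_reflectedSum_diff_eq {e n : ℕ} (he : 2 ≤ e) (hn : n ≤ 2 ^ e + 4) (hn4 : 4 ∣ n)
    (m : ℕ) {x : ℕ} (hx : Odd x) (hmom : ‖oddMoment n (2 ^ (e - 1)) (x - 1)‖ = 1) :
    ‖reflectedSum n (x + 2 ^ (e - 1 + m)) - reflectedSum n x‖ = (2 : ℝ) ^ (-(m : ℤ)) := by
  set M := e - 1 + m with hM
  have hMm : (2 : ℝ) ^ (-(M : ℤ)) ≤ (2 : ℝ) ^ (-((m + 1 : ℕ) : ℤ)) :=
    zpow_le_zpow_right₀ one_le_two (by omega)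
  have hMpos : 0 < 2 ^ M := by positivity
  obtain ⟨y, rfl⟩ : ∃ y, x = y + 1 := ⟨x - 1, by have := hx.pos; omega⟩
  rw [Nat.add_sub_cancel] at hmom
  have hX : y + 1 + 2 ^ M = y + 2 ^ M + 1 := by ring
  set F : ℕ → ℚ_[2] := fun x => oddSum n (fun j => (j : ℚ_[2]) ^ x) with hF
  have hdiff : reflectedSum n (y + 1 + 2 ^ M) - reflectedSum n (y + 1) =
      ∑ i ∈ range (y + 2 ^ M + 1), (-1) ^ i * (n : ℚ_[2]) ^ i *
        (((y + 1 + 2 ^ M).choose (i + 1) : ℚ_[2]) * F (y + 2 ^ M - i) -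
          ((y + 1).choose (i + 1) : ℚ_[2]) * F (y - i)) := by
    have h1 : reflectedSum n (y + 1) = ∑ i ∈ range (y + 2 ^ M + 1), (-1) ^ i * (n : ℚ_[2]) ^ i *
        ((y + 1).choose (i + 1) : ℚ_[2]) * F (y - i) := by
      refine sum_subset (range_mono (by omega)) fun i _ hi => ?_
      rw [mem_range] at hi
      rw [Nat.choose_eq_zero_of_lt (by omega)]
      simp
    rw [h1, reflectedSum, hX, ← sum_sub_distrib]
    refine sum_congr rfl fun i _ => ?_
    simp only [hF, Nat.add_sub_cancel]
    ring
  rw [hdiff, sum_range_succ', add_comm]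
  have hmain : ‖((y + 1 : ℕ) : ℚ_[2]) * (F (y + 2 ^ M) - F y)‖ = (2 : ℝ) ^ (-(m : ℤ)) := by
    rw [norm_mul, norm_natCast_odd hx, one_mul]
    exact norm_oddSum_pow_diff_eq he hn m y hmom
  have h0 : (-1) ^ 0 * (n : ℚ_[2]) ^ 0 * (((y + 1 + 2 ^ M).choose (0 + 1) : ℚ_[2]) *
      F (y + 2 ^ M - 0) - ((y + 1).choose (0 + 1) : ℚ_[2]) * F (y - 0)) =
        ((y + 1 : ℕ) : ℚ_[2]) * (F (y + 2 ^ M) - F y) + 2 ^ M * F (y + 2 ^ M) := by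
    simp only [zero_add, Nat.choose_one_right, Nat.sub_zero]
    push_cast
    ring
  rw [h0, add_assoc, norm_add_eq_left, hmain]
  rw [hmain]
  refine lt_of_le_of_lt (padic_norm_add_le ?_ (padic_norm_sum_le (by positivity) fun i _ => ?_))
    (zpow_neg_succ_lt m)
  · rw [norm_mul, norm_two_pow]
    exact (mul_le_of_le_one_right (by positivity) (norm_oddSum_pow_le _ _)).trans hMm
  · have hC := (norm_pow_mul_choose_sub_le hn4 (y + 1) M (i + 1)).trans hMm
    have hCF : ∀ z, ‖(-1 : ℚ_[2]) ^ (i + 1) * ((n : ℚ_[2]) ^ (i + 1) *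
        (((y + 1 + 2 ^ M).choose (i + 1 + 1) : ℚ_[2]) - ((y + 1).choose (i + 1 + 1) : ℚ_[2]))) *
          F z‖ ≤ (2 : ℝ) ^ (-((m + 1 : ℕ) : ℤ)) := by
      intro z
      rw [norm_mul, norm_mul _ ((n : ℚ_[2]) ^ (i + 1) * _), norm_pow, norm_neg, norm_one, one_pow,
        one_mul]
      exact (mul_le_of_le_one_right (norm_nonneg _) (norm_oddSum_pow_le _ _)).trans hC
    rcases Nat.lt_or_ge y (i + 1) with hi | hi
    -- Here y - (i + 1) may be truncated, but its coefficient is zero.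
    · have h2 := hCF (y + 2 ^ M - (i + 1))
      rw [Nat.choose_eq_zero_of_lt (show y + 1 < i + 1 + 1 by omega)] at h2 ⊢
      convert h2 using 2
      push_cast
      ring
    · have h3 : (-1) ^ (i + 1) * (n : ℚ_[2]) ^ (i + 1) *
          (((y + 1 + 2 ^ M).choose (i + 1 + 1) : ℚ_[2]) * F (y + 2 ^ M - (i + 1)) -
            ((y + 1).choose (i + 1 + 1) : ℚ_[2]) * F (y - (i + 1))) =
          (-1 : ℚ_[2]) ^ (i + 1) * ((n : ℚ_[2]) ^ (i + 1) *
            (((y + 1 + 2 ^ M).choose (i + 1 + 1) : ℚ_[2]) -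
              ((y + 1).choose (i + 1 + 1) : ℚ_[2]))) * F (y - (i + 1)) +
          (((-1) ^ (i + 1) * (n : ℤ) ^ i * ((y + 1 + 2 ^ M).choose (i + 1 + 1) : ℤ) : ℤ) : ℚ_[2]) *
            ((n : ℚ_[2]) * (F (y - (i + 1) + 2 ^ M) - F (y - (i + 1)))) := by
        rw [show y + 2 ^ M - (i + 1) = y - (i + 1) + 2 ^ M by omega]
        push_cast
        ring
      rw [h3]
      refine padic_norm_add_le (hCF _) ?_
      rw [norm_mul]
      refine (mul_le_of_le_one_left (norm_nonneg _) (Padic.norm_int_le_one _)).trans ?_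
      rw [norm_mul, zpow_neg_succ_eq]
      exact mul_le_mul (norm_natCast_even (even_iff_two_dvd.2 (dvd_trans (by norm_num) hn4)))
        (norm_oddSum_pow_diff_le he hn m _) (norm_nonneg _) (by norm_num)

/-! ### The exceptional cases Δ = 4, x odd and Δ = 3, x even -/

/-- This is the origin of c: 2^e + 4 is 8 for e = 2 and 4 times an odd number for e > 2, and one
factor 2 is lost in 2 P_n = n G. -/
theorem norm_two_pow_add_four {e : ℕ} (he : 2 ≤ e) :
    ‖((2 ^ e + 4 : ℕ) : ℚ_[2])‖ =
      (2 : ℝ) ^ (-(((if e = 2 then 2 else 1) + 1 : ℕ) : ℤ)) := by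
  split_ifs with h
  · subst h
    have := norm_two_pow 3
    norm_num at this ⊢
    exact this
  · obtain ⟨d, rfl⟩ : ∃ d, e = d + 3 := ⟨e - 3, by omega⟩
    have h1 : ((2 ^ (d + 3) + 4 : ℕ) : ℚ_[2]) = 2 ^ 2 * ((2 ^ (d + 1) + 1 : ℕ) : ℚ_[2]) := by
      push_cast; ring
    rw [h1, norm_mul, norm_two_pow, norm_natCast_odd, mul_one]
    rw [pow_succ]
    exact ⟨2 ^ d, by ring⟩

theorem norm_of_two_mul_eq {n c : ℕ} {a b : ℚ_[2]}
    (hn : ‖(n : ℚ_[2])‖ = (2 : ℝ) ^ (-((c + 1 : ℕ) : ℤ))) (h : 2 * a = n * b) :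
    ‖a‖ = (2 : ℝ) ^ (-(c : ℤ)) * ‖b‖ := by
  have h1 := congrArg norm h
  have h2 : ‖(2 : ℚ_[2])‖ = 2⁻¹ := by simpa using norm_two_pow 1
  rw [norm_mul, norm_mul, hn, h2, zpow_neg_succ_eq] at h1
  linarith

theorem four_dvd_two_pow_add_four {e : ℕ} (he : 2 ≤ e) : 4 ∣ 2 ^ e + 4 :=
  dvd_add (pow_dvd_pow 2 he) (dvd_refl 4)

theorem two_mul_two_pow_pred {e : ℕ} (he : 2 ≤ e) : 2 ^ e = 2 * 2 ^ (e - 1) := by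
  rw [← pow_succ']; congr 1; omega

theorem even_two_pow_pred {e : ℕ} (he : 2 ≤ e) : Even (2 ^ (e - 1)) :=
  even_two.pow_of_ne_zero (by omega)

theorem norm_oddSum_two_pow_add_four_odd {e x : ℕ} (he : 2 ≤ e) (hx : Odd x) :
    ‖oddSum (2 ^ e + 4) (fun j => (j : ℚ_[2]) ^ x)‖ ≤
      (2 : ℝ) ^ (-((if e = 2 then 2 else 1 : ℕ) : ℤ)) := by
  rw [norm_of_two_mul_eq (norm_two_pow_add_four he) (two_mul_oddSum_pow
    (even_iff_two_dvd.2 (dvd_trans (by norm_num) (four_dvd_two_pow_add_four he))) hx)]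
  exact mul_le_of_le_one_right (by positivity) (norm_reflectedSum_le _ _)

theorem norm_oddSum_two_pow_add_four_even_diff {e x : ℕ} (he : 2 ≤ e) (hx : Even x) (h0 : x ≠ 0)
    (m : ℕ) :
    ‖oddSum (2 ^ e + 4) (fun j => (j : ℚ_[2]) ^ (x + 2 ^ (e - 1 + m))) -
      oddSum (2 ^ e + 4) (fun j => (j : ℚ_[2]) ^ x)‖ = (2 : ℝ) ^ (-(m : ℤ)) := by
  refine norm_oddSum_pow_diff_eq he le_rfl m x ?_
  rw [two_mul_two_pow_pred he]
  exact norm_oddMoment_two_mul_add_four (even_two_pow_pred he) hx h0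

theorem norm_oddSum_two_pow_add_four_odd_diff {e x : ℕ} (he : 2 ≤ e) (hx : Odd x) (h1 : x ≠ 1)
    (m : ℕ) :
    ‖oddSum (2 ^ e + 4) (fun j => (j : ℚ_[2]) ^ (x + 2 ^ (e - 1 + m))) -
      oddSum (2 ^ e + 4) (fun j => (j : ℚ_[2]) ^ x)‖ =
        (2 : ℝ) ^ (-((m + (if e = 2 then 2 else 1) : ℕ) : ℤ)) := by
  have hE : Even (2 ^ e + 4) :=
    even_iff_two_dvd.2 (dvd_trans (by norm_num) (four_dvd_two_pow_add_four he))
  have hx' : Odd (x + 2 ^ (e - 1 + m)) := hx.add_even (even_two.pow_of_ne_zero (by omega))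
  rw [norm_of_two_mul_eq (norm_two_pow_add_four he)
    (b := reflectedSum (2 ^ e + 4) (x + 2 ^ (e - 1 + m)) - reflectedSum (2 ^ e + 4) x)
    (by rw [mul_sub, mul_sub, two_mul_oddSum_pow hE hx', two_mul_oddSum_pow hE hx]),
    norm_reflectedSum_diff_eq he le_rfl (four_dvd_two_pow_add_four he) m hx,
    ← zpow_add₀ two_ne_zero]
  · congr 1
    push_cast
    ring
  · rw [two_mul_two_pow_pred he]
    have := hx.pos
    exact norm_oddMoment_two_mul_add_four (even_two_pow_pred he) (Nat.Odd.sub_odd hx odd_one)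
      (by omega)

theorem oddSum_two_pow_add_three (e x : ℕ) :
    oddSum (2 ^ e + 3) (fun j => (j : ℚ_[2]) ^ x) =
      ((2 ^ e + 4 : ℕ) : ℚ_[2]) * oddSum (2 ^ e + 4) (fun j => (j : ℚ_[2]) ^ x) -
        oddSum (2 ^ e + 4) (fun j => (j : ℚ_[2]) ^ (x + 1)) := by
  have h := oddSum_succ_mul (2 ^ e + 3) (fun j => (j : ℚ_[2]) ^ x)
  simp only [← pow_succ'] at h
  rw [show 2 ^ e + 4 = 2 ^ e + 3 + 1 by ring, h]
  push_cast
  ring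

theorem norm_oddSum_two_pow_add_three_even {e x : ℕ} (he : 2 ≤ e) (hx : Even x) :
    ‖oddSum (2 ^ e + 3) (fun j => (j : ℚ_[2]) ^ x)‖ ≤
      (2 : ℝ) ^ (-((if e = 2 then 2 else 1 : ℕ) : ℤ)) := by
  rw [oddSum_two_pow_add_three]
  refine padic_norm_sub_le ?_ (norm_oddSum_two_pow_add_four_odd he hx.add_one)
  rw [norm_mul, norm_two_pow_add_four he]
  exact (mul_le_of_le_one_right (by positivity) (norm_oddSum_pow_le _ _)).trans
    (zpow_neg_succ_lt _).le

/-- Of the two terms of the recurrence, the one multiplied by 2^e + 4 has increments of valuation m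
+ c + 1, so the odd exponent x + 1 at Δ = 4 decides. -/
theorem norm_oddSum_two_pow_add_three_even_diff {e x : ℕ} (he : 2 ≤ e) (hx : Even x) (h0 : x ≠ 0)
    (m : ℕ) :
    ‖oddSum (2 ^ e + 3) (fun j => (j : ℚ_[2]) ^ (x + 2 ^ (e - 1 + m))) -
      oddSum (2 ^ e + 3) (fun j => (j : ℚ_[2]) ^ x)‖ =
        (2 : ℝ) ^ (-((m + (if e = 2 then 2 else 1) : ℕ) : ℤ)) := by
  have h1 := norm_oddSum_two_pow_add_four_odd_diff he hx.add_one (by omega) m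
  have h2 := norm_oddSum_two_pow_add_four_even_diff he hx h0 m
  rw [← norm_neg] at h1
  rw [show x + 1 + 2 ^ (e - 1 + m) = x + 2 ^ (e - 1 + m) + 1 by ring] at h1
  rw [oddSum_two_pow_add_three, oddSum_two_pow_add_three, ← h1, ← norm_add_eq_left (a := -(_ - _))
    (b := ((2 ^ e + 4 : ℕ) : ℚ_[2]) *
      (oddSum (2 ^ e + 4) (fun j => (j : ℚ_[2]) ^ (x + 2 ^ (e - 1 + m))) -
        oddSum (2 ^ e + 4) (fun j => (j : ℚ_[2]) ^ x)))]
  · congr 1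
    ring
  · rw [h1, norm_mul, h2, norm_two_pow_add_four he, ← zpow_add₀ two_ne_zero]
    refine zpow_lt_zpow_right₀ one_lt_two ?_
    push_cast
    omega

/-! ### All cases together, for natural exponents -/

theorem norm_oddSum_pow_diff {e Δ : ℕ} (he : 2 ≤ e) (hΔ1 : 1 ≤ Δ) (hΔ4 : Δ ≤ 4) {x : ℕ}
    (hx : 2 ≤ x) (m : ℕ) :
    ‖oddSum (2 ^ e + Δ) (fun j => (j : ℚ_[2]) ^ (x + 2 ^ (e - 1 + m))) -
      oddSum (2 ^ e + Δ) (fun j => (j : ℚ_[2]) ^ x)‖ =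
        (2 : ℝ) ^ (-((m + (if (Δ = 3 ∧ x % 2 = 0) ∨ (Δ = 4 ∧ x % 2 = 1) then
          (if e = 2 then 2 else 1) else 0) : ℕ) : ℤ)) := by
  split_ifs with h h2
  · rcases h with ⟨rfl, h⟩ | ⟨rfl, h⟩
    · simpa [h2] using norm_oddSum_two_pow_add_three_even_diff he (Nat.even_iff.2 h) (by omega) m
    · simpa [h2] using norm_oddSum_two_pow_add_four_odd_diff he (Nat.odd_iff.2 h) (by omega) m
  · rcases h with ⟨rfl, h⟩ | ⟨rfl, h⟩
    · simpa [h2] using norm_oddSum_two_pow_add_three_even_diff he (Nat.even_iff.2 h) (by omega) m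
    · simpa [h2] using norm_oddSum_two_pow_add_four_odd_diff he (Nat.odd_iff.2 h) (by omega) m
  · refine norm_oddSum_pow_diff_eq he (by omega) m x ?_
    rw [two_mul_two_pow_pred he]
    have hk := even_two_pow_pred he
    generalize 2 ^ (e - 1) = k at hk
    interval_cases Δ
    · exact norm_oddMoment_top k x
    · rw [oddMoment_two_mul_add_two]
      exact norm_oddMoment_top k x
    · exact (norm_oddMoment_two_mul_add_three hk x).2 (Nat.odd_iff.2 (by omega))
    · exact norm_oddMoment_two_mul_add_four hk (Nat.even_iff.2 (by omega)) (by omega)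

theorem norm_oddSum_pow {e Δ : ℕ} (he : 2 ≤ e) (x : ℕ) :
    ‖oddSum (2 ^ e + Δ) (fun j => (j : ℚ_[2]) ^ x)‖ ≤
        (2 : ℝ) ^ (-((if (Δ = 3 ∧ x % 2 = 0) ∨ (Δ = 4 ∧ x % 2 = 1) then
          (if e = 2 then 2 else 1) else 0 : ℕ) : ℤ)) := by
  split_ifs with h h2
  · rcases h with ⟨rfl, h⟩ | ⟨rfl, h⟩
    · simpa [h2] using norm_oddSum_two_pow_add_three_even he (Nat.even_iff.2 h)
    · simpa [h2] using norm_oddSum_two_pow_add_four_odd he (Nat.odd_iff.2 h)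
  · rcases h with ⟨rfl, h⟩ | ⟨rfl, h⟩
    · simpa [h2] using norm_oddSum_two_pow_add_three_even he (Nat.even_iff.2 h)
    · simpa [h2] using norm_oddSum_two_pow_add_four_odd he (Nat.odd_iff.2 h)
  · simpa using norm_oddSum_pow_le x _

/-! ### Zeros of scaled isometries on ℤ -/

section Isometry

variable {f : ℤ → ℚ_[2]} {c : ℕ}

theorem norm_add_two_pow_mul_sub_le
    (h : ∀ (x : ℤ) (m : ℕ), ‖f (x + 2 ^ m) - f x‖ = (2 : ℝ) ^ (-((m + c : ℕ) : ℤ)))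
    (m s : ℕ) (x : ℤ) : ‖f (x + 2 ^ m * s) - f x‖ ≤ (2 : ℝ) ^ (-((m + c : ℕ) : ℤ)) := by
  induction s with
  | zero => simp; positivity
  | succ s ih =>
    have h1 := h (x + 2 ^ m * s) m
    have h2 : f (x + 2 ^ m * (s + 1 : ℕ)) - f x =
        (f (x + 2 ^ m * s + 2 ^ m) - f (x + 2 ^ m * s)) + (f (x + 2 ^ m * s) - f x) := by
      rw [show x + 2 ^ m * ((s + 1 : ℕ) : ℤ) = x + 2 ^ m * s + 2 ^ m by push_cast; ring]
      ring
    rw [h2]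
    exact padic_norm_add_le h1.le ih

/-- Write the distance as 2^m (2s + 1): one step of 2^m has exact size, and the other s steps of
2^(m+1) contribute strictly less. -/
theorem norm_sub_eq_of_le
    (h : ∀ (x : ℤ) (m : ℕ), ‖f (x + 2 ^ m) - f x‖ = (2 : ℝ) ^ (-((m + c : ℕ) : ℤ)))
    {x y : ℤ} (hxy : y ≤ x) : ‖f x - f y‖ = (2 : ℝ) ^ (-(c : ℤ)) * ‖((x - y : ℤ) : ℚ_[2])‖ := by
  obtain ⟨T, rfl⟩ := Int.le.dest hxy
  rcases eq_or_ne T 0 with rfl | hT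
  · simp
  obtain ⟨m, t, ⟨s, rfl⟩, rfl⟩ := Nat.exists_eq_two_pow_mul_odd hT
  have h1 := h y m
  have h2 := norm_add_two_pow_mul_sub_le h (m + 1) s (y + 2 ^ m)
  have h3 : f (y + (2 ^ m * (2 * s + 1) : ℕ)) - f y =
      (f (y + 2 ^ m) - f y) + (f (y + 2 ^ m + 2 ^ (m + 1) * s) - f (y + 2 ^ m)) := by
    rw [show y + ((2 ^ m * (2 * s + 1) : ℕ) : ℤ) = y + 2 ^ m + 2 ^ (m + 1) * s by push_cast; ring]
    ring
  rw [h3, norm_add_eq_left, h1, add_sub_cancel_left, Int.cast_natCast, Nat.cast_mul, norm_mul,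
    Nat.cast_pow, Nat.cast_two, norm_two_pow, norm_natCast_odd (n := 2 * s + 1) (by simp), mul_one,
    ← zpow_add₀ two_ne_zero]
  · congr 1
    push_cast
    ring
  · rw [h1]
    refine h2.trans_lt (zpow_lt_zpow_right₀ one_lt_two ?_)
    push_cast
    omega

theorem norm_sub_eq
    (h : ∀ (x : ℤ) (m : ℕ), ‖f (x + 2 ^ m) - f x‖ = (2 : ℝ) ^ (-((m + c : ℕ) : ℤ)))
    (x y : ℤ) : ‖f x - f y‖ = (2 : ℝ) ^ (-(c : ℤ)) * ‖((x - y : ℤ) : ℚ_[2])‖ := by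
  rcases le_total y x with hxy | hxy
  · exact norm_sub_eq_of_le h hxy
  · rw [norm_sub_rev, norm_sub_eq_of_le h hxy, Int.cast_sub, Int.cast_sub, norm_sub_rev (x : ℚ_[2])]

/-- If f(a) is not already smaller, it has the same norm as the increment by 2^m, and their sum
gains a digit. -/
theorem exists_approximate_zero_succ
    (h : ∀ (x : ℤ) (m : ℕ), ‖f (x + 2 ^ m) - f x‖ = (2 : ℝ) ^ (-((m + c : ℕ) : ℤ)))
    {m : ℕ} {a : ℤ} (ha : ‖f a‖ ≤ (2 : ℝ) ^ (-((m + c : ℕ) : ℤ))) :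
    ∃ b : ℤ, (2 : ℤ) ^ m ∣ b - a ∧ ‖f b‖ ≤ (2 : ℝ) ^ (-((m + 1 + c : ℕ) : ℤ)) := by
  rcases ha.lt_or_eq with hlt | heq
  · refine ⟨a, by simp, ?_⟩
    have := (Padic.norm_le_pow_iff_norm_lt_pow_add_one (p := 2) (f a)
      (-((m + 1 + c : ℕ) : ℤ))).2
    push_cast at this hlt ⊢
    refine this ?_
    rwa [show -((m : ℤ) + 1 + c) + 1 = -((m : ℤ) + c) by ring]
  · refine ⟨a + 2 ^ m, by simp, ?_⟩
    have := norm_add_le_of_norm_eq (h a m) heq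
    rw [sub_add_cancel] at this
    rwa [show m + 1 + c = m + c + 1 by ring]

/-- A function on `ℤ` that scales 2-adic distances by `2 ^ (-c)` and takes a value in `2 ^ c ℤ_[2]`
has a zero in `ℤ_[2]`, in the sense that `‖f x‖` is the scaled distance of `x` to it. -/
theorem exists_padicInt_zero (h0 : ‖f 0‖ ≤ (2 : ℝ) ^ (-(c : ℤ)))
    (h : ∀ (x : ℤ) (m : ℕ), ‖f (x + 2 ^ m) - f x‖ = (2 : ℝ) ^ (-((m + c : ℕ) : ℤ))) :
    ∃ x₀ : ℤ_[2], ∀ x : ℤ, ‖f x‖ = (2 : ℝ) ^ (-(c : ℤ)) * ‖(x : ℤ_[2]) - x₀‖ := by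
  choose! next hnext using fun (m : ℕ) (a : ℤ) => exists_approximate_zero_succ h (m := m) (a := a)
  set a : ℕ → ℤ := fun m => Nat.rec 0 (fun m a => next m a) m with ha
  have hfa : ∀ m, ‖f (a m)‖ ≤ (2 : ℝ) ^ (-((m + c : ℕ) : ℤ)) := by
    intro m
    induction m with
    | zero =>
      change ‖f 0‖ ≤ _
      simpa using h0
    | succ m ih => exact (hnext m (a m) ih).2
  have hstep : ∀ m, dist ((a m : ℤ) : ℤ_[2]) (a (m + 1) : ℤ) ≤ 2 / 2 / 2 ^ m := by
    intro m
    rw [dist_comm, dist_eq_norm, ← Int.cast_sub]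
    refine ((PadicInt.norm_int_le_pow_iff_dvd (p := 2) (n := m)).2
      (by exact_mod_cast (hnext m (a m) (hfa m)).1)).trans_eq ?_
    simp
  obtain ⟨x₀, hx₀⟩ := cauchySeq_tendsto_of_complete (cauchySeq_of_le_geometric_two hstep)
  refine ⟨x₀, fun x => ?_⟩
  have hlim : Tendsto (fun m => f (a m)) atTop (𝓝 0) := by
    refine squeeze_zero_norm (a := fun m : ℕ => (1 / 2 : ℝ) ^ m) (fun m => (hfa m).trans ?_)
      (tendsto_pow_atTop_nhds_zero_of_lt_one (by norm_num) (by norm_num))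
    rw [one_div, inv_pow, ← zpow_natCast, ← zpow_neg]
    exact zpow_le_zpow_right₀ one_le_two (by push_cast; omega)
  have h1 : Tendsto (fun m => ‖f x - f (a m)‖) atTop (𝓝 ‖f x‖) := by
    simpa using (tendsto_const_nhds.sub hlim).norm
  have h2 : Tendsto (fun m => (2 : ℝ) ^ (-(c : ℤ)) * ‖(x : ℤ_[2]) - (a m : ℤ)‖) atTop
      (𝓝 ((2 : ℝ) ^ (-(c : ℤ)) * ‖(x : ℤ_[2]) - x₀‖)) :=
    (tendsto_const_nhds.sub hx₀).norm.const_mul _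
  refine tendsto_nhds_unique h1 (h2.congr fun m => ?_)
  rw [norm_sub_eq h, ← Int.cast_sub, PadicInt.norm_def, PadicInt.coe_intCast]

end Isometry

/-! ### Extension to negative exponents and conclusion -/

theorem norm_pow_two_pow_sub_one_le {y : ℚ_[2]} (hy : ‖y‖ = 1) (S : ℕ) :
    ‖y ^ 2 ^ S - 1‖ ≤ (2 : ℝ) ^ (-(S : ℤ)) := by
  induction S with
  | zero => simpa using padic_norm_sub_le (r := 1) hy.le norm_one.le
  | succ S ih =>
    have h1 : ‖y ^ 2 ^ S + 1‖ ≤ 2⁻¹ := by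
      simpa using norm_add_le_of_norm_eq (a := y ^ 2 ^ S) (b := 1) (k := 0) (by simp [hy])
        (by simp)
    have h2 : y ^ 2 ^ (S + 1) - 1 = (y ^ 2 ^ S + 1) * (y ^ 2 ^ S - 1) := by
      rw [pow_succ, pow_mul]; ring
    rw [h2, norm_mul, zpow_neg_succ_eq]
    exact mul_le_mul h1 ih (norm_nonneg _) (by norm_num)

theorem norm_oddSum_zpow_diff_le (n S : ℕ) (a : ℤ) :
    ‖oddSum n (fun j => (j : ℚ_[2]) ^ (a + 2 ^ S)) - oddSum n (fun j => (j : ℚ_[2]) ^ a)‖ ≤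
      ‖((n.factorial : ℚ_[2])⁻¹)‖ * (2 : ℝ) ^ (-(S : ℤ)) := by
  rw [← oddSum_sub, oddSum, norm_mul]
  refine mul_le_mul_of_nonneg_left (padic_norm_sum_le (by positivity) fun j hj => ?_)
    (norm_nonneg _)
  have hj1 := norm_natCast_odd (mem_filter.1 hj).2
  have hj0 : (j : ℚ_[2]) ≠ 0 := by
    intro h
    simp [h] at hj1
  have h1 : (j : ℚ_[2]) ^ (a + 2 ^ S) - (j : ℚ_[2]) ^ a =
      (j : ℚ_[2]) ^ a * ((j : ℚ_[2]) ^ 2 ^ S - 1) := by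
    rw [zpow_add₀ hj0, mul_sub, mul_one]
    norm_cast
  rw [h1, norm_mul, norm_mul, norm_zpow, hj1, one_zpow, one_mul]
  exact (mul_le_of_le_one_left (norm_nonneg _) (norm_natCast_le_one _)).trans
    (norm_pow_two_pow_sub_one_le hj1 S)

theorem norm_oddSum_zpow_diff {e Δ p : ℕ} (he : 2 ≤ e) (hΔ1 : 1 ≤ Δ) (hΔ4 : Δ ≤ 4)
    (x : ℤ) (m : ℕ) :
    ‖oddSum (2 ^ e + Δ) (fun j => (j : ℚ_[2]) ^ (2 ^ (e - 1) * (x + 2 ^ m) + (p : ℤ))) -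
      oddSum (2 ^ e + Δ) (fun j => (j : ℚ_[2]) ^ (2 ^ (e - 1) * x + (p : ℤ)))‖ =
        (2 : ℝ) ^ (-((m + (if (Δ = 3 ∧ p % 2 = 0) ∨ (Δ = 4 ∧ p % 2 = 1) then
          (if e = 2 then 2 else 1) else 0) : ℕ) : ℤ)) := by
  set c := if (Δ = 3 ∧ p % 2 = 0) ∨ (Δ = 4 ∧ p % 2 = 1) then (if e = 2 then 2 else 1) else 0 with hc
  set n := 2 ^ e + Δ with hn
  set f : ℤ → ℚ_[2] := fun x => oddSum n (fun j => (j : ℚ_[2]) ^ (2 ^ (e - 1) * x + (p : ℤ)))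
    with hf
  change ‖f (x + 2 ^ m) - f x‖ = _
  have hlim : Tendsto (fun S : ℕ => ‖((n.factorial : ℚ_[2])⁻¹)‖ * (2 : ℝ) ^ (-(S : ℤ))) atTop
      (𝓝 0) := by
    have := (tendsto_pow_atTop_nhds_zero_of_lt_one (r := (1 / 2 : ℝ)) (by norm_num)
      (by norm_num)).const_mul ‖((n.factorial : ℚ_[2])⁻¹)‖
    simpa using this
  -- T is so large that a shift by 2^T changes f by less than the claimed norm and makes the
  -- argument positive.
  obtain ⟨T, hTn, hTx⟩ := ((hlim.eventually (gt_mem_nhds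
    (show (0 : ℝ) < (2 : ℝ) ^ (-((m + c : ℕ) : ℤ)) by positivity))).and
      (eventually_ge_atTop (x.natAbs + 2))).exists
  have hstep : ∀ z : ℤ, ‖f (z + 2 ^ T) - f z‖ < (2 : ℝ) ^ (-((m + c : ℕ) : ℤ)) := by
    intro z
    refine lt_of_le_of_lt ?_ hTn
    have := norm_oddSum_zpow_diff_le n (e - 1 + T) (2 ^ (e - 1) * z + (p : ℤ))
    simp only [hf]
    rw [show (2 : ℤ) ^ (e - 1) * (z + 2 ^ T) + (p : ℤ) =
      2 ^ (e - 1) * z + (p : ℤ) + 2 ^ (e - 1 + T) by ring]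
    refine this.trans (mul_le_mul_of_nonneg_left (zpow_le_zpow_right₀ one_le_two ?_)
      (norm_nonneg _))
    push_cast
    omega
  -- The summand 2 keeps the exponent at least 2, away from the exponents 0 and 1 excluded above.
  obtain ⟨w, hw⟩ : ∃ w : ℕ, x + 2 ^ T = w + 2 := by
    have h1 : x.natAbs + 2 < 2 ^ T := hTx.trans_lt Nat.lt_two_pow_self
    have h2 : ((x.natAbs + 2 : ℕ) : ℤ) < 2 ^ T := by exact_mod_cast h1
    exact ⟨(x + 2 ^ T - 2).toNat, by omega⟩
  have hmain : ‖f (w + 2 + 2 ^ m) - f (w + 2)‖ = (2 : ℝ) ^ (-((m + c : ℕ) : ℤ)) := by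
    have hq := even_two_pow_pred he
    have hpos : 0 < 2 ^ (e - 1) := by positivity
    have h1 := norm_oddSum_pow_diff he hΔ1 hΔ4 (x := 2 ^ (e - 1) * (w + 2) + p) (by nlinarith) m
    have hpar : (2 ^ (e - 1) * (w + 2) + p) % 2 = p % 2 := by
      obtain ⟨t, ht⟩ := (hq.mul_right (w + 2)).two_dvd
      omega
    rw [hpar, ← hc] at h1
    rw [← h1]
    simp only [hf]
    congr 2
    · refine oddSum_congr fun j _ _ => ?_
      rw [← zpow_natCast]
      congr 1
      push_cast
      ring
    · refine oddSum_congr fun j _ _ => ?_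
      rw [← zpow_natCast]
      congr 1
  have hsplit : f (x + 2 ^ m) - f x = (f (w + 2 + 2 ^ m) - f (w + 2)) +
      ((f (x + 2 ^ T) - f x) - (f (x + 2 ^ m + 2 ^ T) - f (x + 2 ^ m))) := by
    rw [show x + 2 ^ m + 2 ^ T = x + 2 ^ T + 2 ^ m by ring, hw]
    ring
  rw [hsplit, norm_add_eq_left, hmain]
  rw [hmain, sub_eq_add_neg]
  refine (Padic.nonarchimedean _ _).trans_lt (max_lt (hstep x) ?_)
  rw [norm_neg]
  exact hstep _

theorem nu_eq_add_of_norm_eq {a b : ℚ_[2]} {c : ℕ} (h : ‖a‖ = (2 : ℝ) ^ (-(c : ℤ)) * ‖b‖) :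
    nu a = nu b + ((c : ℤ) : WithTop ℤ) := by
  unfold nu
  rcases eq_or_ne b 0 with rfl | hb
  · rw [norm_zero, mul_zero, norm_eq_zero] at h
    simp [h]
  · have ha : a ≠ 0 := by
      rw [← norm_pos_iff, h]
      exact mul_pos (by positivity) (norm_pos_iff.2 hb)
    rw [Padic.addValuation.apply ha, Padic.addValuation.apply hb, ← WithTop.coe_add]
    rw [Padic.norm_eq_zpow_neg_valuation ha, Padic.norm_eq_zpow_neg_valuation hb, Nat.cast_two,
      ← zpow_add₀ two_ne_zero] at h
    have := zpow_right_injective₀ two_pos (by norm_num) h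
    congr 1
    omega

theorem theorem2p1 (e Δ p : ℕ) (he : 2 ≤ e) (hΔ1 : 1 ≤ Δ) (hΔ4 : Δ ≤ 4)
    (hp : p < 2 ^ (e - 1)) :
    ∃ x₀ : ℤ_[2], ∀ x : ℤ,
      nu ((partialStirling (2 ^ e + Δ) (2 ^ (e - 1) * x + (p : ℤ)) : ℚ) : ℚ_[2]) =
        nu (((x : ℤ_[2]) - x₀ : ℤ_[2]) : ℚ_[2]) +
          (if (Δ = 3 ∧ p % 2 = 0) ∨ (Δ = 4 ∧ p % 2 = 1) then
            (if e = 2 then 2 else 1)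
          else 0) := by
  obtain ⟨x₀, hx₀⟩ := exists_padicInt_zero
    (f := fun x => oddSum (2 ^ e + Δ) (fun j => (j : ℚ_[2]) ^ (2 ^ (e - 1) * x + (p : ℤ))))
    (by simpa using norm_oddSum_pow he p) (norm_oddSum_zpow_diff he hΔ1 hΔ4)
  refine ⟨x₀, fun x => ?_⟩
  rw [partialStirling_eq_oddSum, nu_eq_add_of_norm_eq (hx₀ x)]
  congr 1
  split_ifs <;> rfl
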